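/- Let $(R,\mathfrak m)$ be a commutative Noetherian local ring and let $L$ and $N$ be finitely generated $R$-modules. Let $M\subseteq L$ be a Burch submodule, that is, a submodule with $\mathfrak m\,(M:_L\mathfrak m)\neq \mathfrak m M$, where $(M:_L\mathfrak m)=\{x\in L : \mathfrak m x\subseteq M\}$. Let $n\ge 0$ be an integer with $n\ge \operatorname{depth}_R(N)$ such that $$\operatorname{Ext}_R^i(M,N)=0 \text{ for } i=n-1,\,n,\,n+1 \quad\text{and}\quad \operatorname{Ext}_R^j(L,N)=0 \text{ for } j=n,\,n+1,$$ where $\operatorname{Ext}^{-1}_R=0$ by convention. Then the injective dimension $\operatorname{id}_R(N)$ is finite. -/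

import Mathlib

/-- The colon submodule `(M :_L I) = {x ∈ L | I x ⊆ M}` of `L`, for a submodule `M` of `L` and an
ideal `I` of `R`. -/
def Submodule.colonIdeal {R L : Type*} [CommRing R] [AddCommGroup L] [Module R L]
    (M : Submodule R L) (I : Ideal R) : Submodule R L where
  carrier := {x | ∀ a ∈ I, a • x ∈ M}
  add_mem' hx hy a ha := by
    rw [smul_add]
    exact M.add_mem (hx a ha) (hy a ha)
  zero_mem' a _ := by
    rw [smul_zero]
    exact M.zero_mem
  smul_mem' r x hx a ha := by
    rw [smul_comm]
    exact M.smul_mem r (hx a ha)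

/-- A submodule `M` of a module `L` over a local ring `(R, 𝔪)` is a Burch submodule if
`𝔪 (M :_L 𝔪) ≠ 𝔪 M`. -/
def Submodule.IsBurch {R L : Type*} [CommRing R] [IsLocalRing R] [AddCommGroup L] [Module R L]
    (M : Submodule R L) : Prop :=
  IsLocalRing.maximalIdeal R • M.colonIdeal (IsLocalRing.maximalIdeal R) ≠
    IsLocalRing.maximalIdeal R • M

/-- The depth of a module `N` over a local ring `(R, 𝔪)`: the supremum of the lengths of the
weakly regular sequences on `N` with entries in `𝔪`. If `N` is finitely generated and nonzero, then
`N ≠ 𝔪 N` by Nakayama's lemma, so these are exactly the `N`-regular sequences in `𝔪`; for `N = 0` one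
gets the usual convention `depth 0 = ∞`. -/
noncomputable def Module.localDepth (R N : Type*) [CommRing R] [IsLocalRing R] [AddCommGroup N]
    [Module R N] : ℕ∞ :=
  ⨆ (rs : List R) (_ : (∀ r ∈ rs, r ∈ IsLocalRing.maximalIdeal R) ∧
    RingTheory.Sequence.IsWeaklyRegular N rs), (rs.length : ℕ∞)

universe u

open CategoryTheory CategoryTheory.Abelian IsLocalRing

/-! Write `k` for the residue field. The Burch condition gives `a ∈ 𝔪` and `u ∈ (M :_L 𝔪)` with `a u
∉ 𝔪 M`. In the cokernel `W` of `M → L × M`, `m ↦ (m, a m)`, the class of `(u, a u)` is a socle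
element outside `𝔪 W`, so `k` is a direct summand of `W`. The long exact sequence kills `Ext^n(W,
N)`, hence `Ext^n(k, N) = 0` (`Submodule.IsBurch.extZero_residue`).

It remains to see that the Bass numbers of a finite module have no gap: once one is nonzero and the
next is zero, all later ones vanish (`extZero_residue_of_finite`). By faithful flatness `N` may be
replaced by `Q = R̂ ⊗ N`, still viewed over `R`; the gain is that `Q` is derived complete along
every `y ∈ 𝔪`. Let `I` be the minimal injective resolution of `Q` over `R`, and `V` the quotient of
a term of `I` by its `𝔪`-torsion. Then `V` is filtered by modules on which some `y ∈ 𝔪` is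
invertible, so `Ext(V, Q) = 0` in all degrees and `Hom(V, I)` is exact. If `I^a` and some later
`I^b` have nonzero socle while `I^(a+1)` and `I^(b-1)` have none, injectivity gives `g : I^b → I^a`
that is nonzero on the socle. Exactness of `Hom(V, I)` corrects `g` to a cycle and continues it
downwards to degree 0, where it stops; so `g` is null homotopic, and by minimality it vanishes on
socles, a contradiction.

Some Bass number in degree at most the depth is nonzero and the `n`-th is zero, so all large ones
vanish. Noetherian induction on ideals and Baer's criterion then bound the injective dimension. -/

/-- Vanishing of `Ext^i_R(A, B)`, for unbundled modules. -/
abbrev ExtZero (R : Type u) [CommRing R] (A B : Type u) [AddCommGroup A] [Module R A]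
    [AddCommGroup B] [Module R B] (i : ℕ) : Prop :=
  Subsingleton (Ext (ModuleCat.of R A) (ModuleCat.of R B) i)

/-! ### Long exact sequences of `Ext` as vanishing statements -/

namespace ExtZero

variable {R : Type u} [CommRing R] {A B C N : Type u}
  [AddCommGroup A] [Module R A] [AddCommGroup B] [Module R B] [AddCommGroup C] [Module R C]
  [AddCommGroup N] [Module R N]

theorem zero_iff : ExtZero R A N 0 ↔ ∀ f : A →ₗ[R] N, f = 0 := by
  have e : Ext (ModuleCat.of R A) (ModuleCat.of R N) 0 ≃+ (A →ₗ[R] N) :=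
    Ext.addEquiv₀.trans ModuleCat.homAddEquiv
  exact e.toEquiv.subsingleton_congr.trans
    ⟨fun _ f => Subsingleton.elim _ _, fun h => ⟨fun f g => (h f).trans (h g).symm⟩⟩

theorem of_retract (s : A →ₗ[R] B) (r : B →ₗ[R] A) (h : r ∘ₗ s = LinearMap.id) {i : ℕ}
    (hB : ExtZero R B N i) : ExtZero R A N i := by
  refine subsingleton_of_forall_eq 0 fun x => ?_
  have hsr : ModuleCat.ofHom s ≫ ModuleCat.ofHom r = 𝟙 _ := by
    rw [← ModuleCat.ofHom_comp, h]; rfl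
  rw [← Ext.mk₀_id_comp x, ← hsr, ← Ext.mk₀_comp_mk₀_assoc, hB.elim (Ext.comp _ _ _) 0,
    Ext.comp_zero]

theorem of_subsingleton [Subsingleton A] (i : ℕ) : ExtZero R A N i := by
  refine subsingleton_of_forall_eq 0 fun x => ?_
  have h : 𝟙 (ModuleCat.of R A) = 0 := by
    ext a; exact Subsingleton.elim _ _
  rw [← Ext.mk₀_id_comp x, h, Ext.mk₀_zero, Ext.zero_comp]

theorem of_projective [Module.Projective R A] (i : ℕ) : ExtZero R A N (i + 1) := by
  have : Projective (ModuleCat.of R A) := (IsProjective.iff_projective _).1 inferInstance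
  exact Ext.subsingleton_of_projective _ _ i

theorem of_injective [h : Module.Injective R N] (i : ℕ) : ExtZero R A N (i + 1) := by
  have : Injective (ModuleCat.of R N) := (Module.injective_iff_injective_object R N).1 h
  exact Ext.subsingleton_of_injective _ _ i

section Sequence

variable {f : A →ₗ[R] B} {g : B →ₗ[R] C}

theorem shortExact (hf : Function.Injective f) (hfg : Function.Exact f g)
    (hg : Function.Surjective g) :
    (ModuleCat.shortComplexOfCompEqZero f g hfg.linearMap_comp_eq_zero).ShortExact :=
  ModuleCat.shortComplex_shortExact _ hfg hf hg

theorem third (hf : Function.Injective f) (hfg : Function.Exact f g)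
    (hg : Function.Surjective g) {i : ℕ} (hA : ExtZero R A N i) (hB : ExtZero R B N (i + 1)) :
    ExtZero R C N (i + 1) := by
  refine subsingleton_of_forall_eq 0 fun x => ?_
  obtain ⟨y, rfl⟩ := Ext.contravariant_sequence_exact₃ (shortExact hf hfg hg) _ x
    (hB.elim _ _) (add_comm 1 i)
  rw [hA.elim y 0, Ext.comp_zero]

theorem third_zero (hg : Function.Surjective g) (hB : ExtZero R B N 0) : ExtZero R C N 0 := by
  rw [zero_iff] at hB ⊢
  intro φ
  ext c
  obtain ⟨b, rfl⟩ := hg c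
  exact LinearMap.congr_fun (hB (φ ∘ₗ g)) b

theorem middle (hf : Function.Injective f) (hfg : Function.Exact f g)
    (hg : Function.Surjective g) {i : ℕ} (hA : ExtZero R A N i) (hC : ExtZero R C N i) :
    ExtZero R B N i := by
  refine subsingleton_of_forall_eq 0 fun x => ?_
  obtain ⟨y, rfl⟩ := Ext.contravariant_sequence_exact₂ (shortExact hf hfg hg) _ x (hA.elim _ _)
  rw [hC.elim y 0, Ext.comp_zero]

theorem first (hf : Function.Injective f) (hfg : Function.Exact f g)
    (hg : Function.Surjective g) {i : ℕ} (hB : ExtZero R B N i) (hC : ExtZero R C N (i + 1)) :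
    ExtZero R A N i := by
  refine subsingleton_of_forall_eq 0 fun x => ?_
  obtain ⟨y, rfl⟩ := Ext.contravariant_sequence_exact₁ (shortExact hf hfg hg) _ x
    (add_comm 1 i) (hC.elim _ _)
  rw [hB.elim y 0, Ext.comp_zero]

theorem target_third (hf : Function.Injective f) (hfg : Function.Exact f g)
    (hg : Function.Surjective g) {i : ℕ} (hA : ExtZero R N A (i + 1)) (hB : ExtZero R N B i) :
    ExtZero R N C i := by
  refine subsingleton_of_forall_eq 0 fun x => ?_
  obtain ⟨y, rfl⟩ := Ext.covariant_sequence_exact₃ _ (shortExact hf hfg hg) x rfl (hA.elim _ _)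
  rw [hB.elim y 0, Ext.zero_comp]

theorem target_first (hf : Function.Injective f) (hfg : Function.Exact f g)
    (hg : Function.Surjective g) {i : ℕ} (hB : ExtZero R N B (i + 1)) (hC : ExtZero R N C i) :
    ExtZero R N A (i + 1) := by
  refine subsingleton_of_forall_eq 0 fun x => ?_
  obtain ⟨y, rfl⟩ := Ext.covariant_sequence_exact₁ _ (shortExact hf hfg hg) x (hB.elim _ _) rfl
  rw [hC.elim y 0, Ext.zero_comp]

/-- If `Ext¹(N, A)` vanishes then maps from `N` lift along the quotient `B → C` by `A`. -/
theorem exists_lift (hf : Function.Injective f) (hfg : Function.Exact f g)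
    (hg : Function.Surjective g) (hA : ExtZero R N A 1) (φ : N →ₗ[R] C) :
    ∃ ψ : N →ₗ[R] B, g ∘ₗ ψ = φ := by
  obtain ⟨y, hy⟩ := Ext.covariant_sequence_exact₃ _ (shortExact hf hfg hg)
    (Ext.mk₀ (ModuleCat.ofHom φ)) (zero_add 1) (hA.elim _ _)
  obtain ⟨ψ, rfl⟩ := (Ext.mk₀_bijective _ _).2 y
  rw [Ext.mk₀_comp_mk₀] at hy
  have := (Ext.mk₀_bijective _ _).1 hy
  refine ⟨ψ.hom, ?_⟩
  ext x
  exact LinearMap.congr_fun (congrArg ModuleCat.Hom.hom this) x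

/-- Conversely to `exists_lift`, if `Ext¹(N, B)` vanishes. -/
theorem one_of_forall_lift (hf : Function.Injective f) (hfg : Function.Exact f g)
    (hg : Function.Surjective g) (hB : ExtZero R N B 1)
    (h : ∀ φ : N →ₗ[R] C, ∃ ψ : N →ₗ[R] B, g ∘ₗ ψ = φ) : ExtZero R N A 1 := by
  refine subsingleton_of_forall_eq 0 fun x => ?_
  obtain ⟨y, rfl⟩ := Ext.covariant_sequence_exact₁ _ (shortExact hf hfg hg) x (hB.elim _ _)
    (zero_add 1)
  obtain ⟨φ, rfl⟩ := (Ext.mk₀_bijective _ _).2 y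
  obtain ⟨ψ, hψ⟩ := h φ.hom
  have : φ = ModuleCat.ofHom ψ ≫ ModuleCat.ofHom g := by
    rw [← ModuleCat.ofHom_comp, hψ]; rfl
  subst this
  rw [← Ext.mk₀_comp_mk₀, Ext.comp_assoc_of_second_deg_zero]
  have := (shortExact hf hfg hg).comp_extClass
  erw [this]
  rw [Ext.comp_zero]

/-- If `Ext¹(C, N)` vanishes then maps from the submodule `A` to `N` extend to `B`. -/
theorem exists_extend (hf : Function.Injective f) (hfg : Function.Exact f g)
    (hg : Function.Surjective g) (hC : ExtZero R C N 1) (φ : A →ₗ[R] N) :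
    ∃ ψ : B →ₗ[R] N, ψ ∘ₗ f = φ := by
  obtain ⟨y, hy⟩ := Ext.contravariant_sequence_exact₁ (shortExact hf hfg hg) _
    (Ext.mk₀ (ModuleCat.ofHom φ)) (add_zero 1) (hC.elim _ _)
  obtain ⟨ψ, rfl⟩ := (Ext.mk₀_bijective _ _).2 y
  rw [Ext.mk₀_comp_mk₀] at hy
  have := (Ext.mk₀_bijective _ _).1 hy
  refine ⟨ψ.hom, ?_⟩
  ext x
  exact LinearMap.congr_fun (congrArg ModuleCat.Hom.hom this) x

/-- Conversely to `exists_extend`, if `Ext¹(B, N)` vanishes. -/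
theorem one_of_forall_extend (hf : Function.Injective f) (hfg : Function.Exact f g)
    (hg : Function.Surjective g) (hB : ExtZero R B N 1)
    (h : ∀ φ : A →ₗ[R] N, ∃ ψ : B →ₗ[R] N, ψ ∘ₗ f = φ) : ExtZero R C N 1 := by
  refine subsingleton_of_forall_eq 0 fun x => ?_
  obtain ⟨y, rfl⟩ := Ext.contravariant_sequence_exact₃ (shortExact hf hfg hg) _ x (hB.elim _ _)
    (add_zero 1)
  obtain ⟨φ, rfl⟩ := (Ext.mk₀_bijective _ _).2 y
  obtain ⟨ψ, hψ⟩ := h φ.hom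
  have : φ = ModuleCat.ofHom f ≫ ModuleCat.ofHom ψ := by
    rw [← ModuleCat.ofHom_comp, hψ]; rfl
  subst this
  rw [← Ext.mk₀_comp_mk₀, ← Ext.comp_assoc_of_second_deg_zero]
  have := (shortExact hf hfg hg).extClass_comp
  erw [this]
  rw [Ext.zero_comp]

end Sequence

theorem prod {i : ℕ} (hA : ExtZero R A N i) (hB : ExtZero R B N i) : ExtZero R (A × B) N i :=
  middle (f := LinearMap.inl R A B) (g := LinearMap.snd R A B) LinearMap.inl_injective
    (fun x => by
      constructor
      · intro h; exact ⟨x.1, Prod.ext rfl h.symm⟩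
      · rintro ⟨a, rfl⟩; rfl)
    LinearMap.snd_surjective hA hB

end ExtZero

/-! ### The Burch condition and the residue field -/

/-- A socle element outside `𝔪 W` splits off a copy of the residue field. -/
theorem exists_retract_residue {R W : Type u} [CommRing R] [IsLocalRing R] [AddCommGroup W]
    [Module R W] (w : W) (hw : ∀ r ∈ maximalIdeal R, r • w = 0)
    (hw' : w ∉ maximalIdeal R • (⊤ : Submodule R W)) :
    ∃ (s : (R ⧸ maximalIdeal R) →ₗ[R] W) (r : W →ₗ[R] (R ⧸ maximalIdeal R)),
      r ∘ₗ s = LinearMap.id := by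
  let _ : Field (R ⧸ maximalIdeal R) := Ideal.Quotient.field _
  let V := W ⧸ (maximalIdeal R • (⊤ : Submodule R W))
  have hv : (Submodule.Quotient.mk w : V) ≠ 0 := by
    rwa [Ne, Submodule.Quotient.mk_eq_zero]
  obtain ⟨φ, hφ⟩ := Module.Projective.exists_dual_eq_one (R ⧸ maximalIdeal R) hv
  let s : (R ⧸ maximalIdeal R) →ₗ[R] W :=
    Submodule.liftQ _ (LinearMap.toSpanSingleton R W w) (fun r hr => hw r hr)
  refine ⟨s, φ.restrictScalars R ∘ₗ Submodule.mkQ _, ?_⟩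
  ext
  exact (congrArg (fun v : V => φ v) (congrArg Submodule.Quotient.mk (one_smul R w))).trans hφ

/-- Over a Burch submodule `M ⊆ L`, with `a ∈ 𝔪` and `u ∈ (M :_L 𝔪)` such that `a u ∉ 𝔪 M`, the
residue field is a direct summand of the cokernel of `M → L × M`, `m ↦ (m, a m)`. Vanishing of
`Ext` of `M` and `L` thus passes to the residue field. -/
theorem Submodule.IsBurch.extZero_residue {R L N : Type u} [CommRing R] [IsLocalRing R]
    [AddCommGroup L] [Module R L] [AddCommGroup N] [Module R N] {M : Submodule R L}
    (hM : M.IsBurch) {n : ℕ} (hpred : ∀ i, i + 1 = n → ExtZero R M N i)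
    (hMn : ExtZero R M N n) (hLn : ExtZero R L N n) :
    ExtZero R (R ⧸ maximalIdeal R) N n := by
  have hle : maximalIdeal R • M ≤ maximalIdeal R • M.colonIdeal (maximalIdeal R) :=
    Submodule.smul_mono le_rfl fun x hx a _ => M.smul_mem a hx
  have hnle : ¬ maximalIdeal R • M.colonIdeal (maximalIdeal R) ≤ maximalIdeal R • M :=
    fun h => hM (le_antisymm h hle)
  obtain ⟨a, ha, u, hu, hau⟩ : ∃ a ∈ maximalIdeal R, ∃ u ∈ M.colonIdeal (maximalIdeal R),
      a • u ∉ maximalIdeal R • M := by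
    by_contra! h
    exact hnle (Submodule.smul_le.2 h)
  let f : M →ₗ[R] L × M := M.subtype.prod (a • LinearMap.id)
  let g := (LinearMap.range f).mkQ
  have hf : Function.Injective f := fun x y h => Subtype.ext (congrArg Prod.fst h)
  have hfg : Function.Exact f g := f.exact_map_mkQ_range
  have hg : Function.Surjective g := Submodule.mkQ_surjective _
  have hB : ExtZero R (L × M) N n := hLn.prod hMn
  have hW : ExtZero R ((L × M) ⧸ LinearMap.range f) N n := by
    cases n with
    | zero => exact ExtZero.third_zero hg hB
    | succ i => exact ExtZero.third hf hfg hg (hpred i rfl) hB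
  -- For `r ∈ 𝔪` one has `r u ∈ M` and `r (u, a u) = f (r u)`, so the class is in the socle. If it
  -- were in `𝔪 W`, comparing second coordinates modulo the image of `f` would give `a u ∈ 𝔪 M + a M
  -- = 𝔪 M`.
  obtain ⟨s, r, hsr⟩ := exists_retract_residue (g (u, ⟨a • u, hu a ha⟩)) (by
      intro r hr
      rw [← map_smul]
      refine (hfg _).2 ⟨⟨r • u, hu r hr⟩, Prod.ext rfl (Subtype.ext ?_)⟩
      exact smul_comm a r u) (by
      intro h
      have htop : (⊤ : Submodule R ((L × M) ⧸ LinearMap.range f)) = Submodule.map g ⊤ := by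
        rw [Submodule.map_top, LinearMap.range_eq_top.2 hg]
      rw [htop, ← Submodule.map_smul''] at h
      obtain ⟨p, hp, hpu⟩ := h
      rw [← sub_eq_zero, ← map_sub] at hpu
      obtain ⟨m, hm⟩ := (hfg _).1 hpu
      let q : L × M →ₗ[R] L := M.subtype ∘ₗ LinearMap.snd R L M
      have hq : Submodule.map q ⊤ ≤ M := by
        rintro _ ⟨x, -, rfl⟩
        exact x.2.2
      have h1 : q p ∈ maximalIdeal R • M := by
        refine Submodule.smul_mono le_rfl hq ?_
        rw [← Submodule.map_smul'']
        exact Submodule.mem_map_of_mem hp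
      have h2 := congrArg q hm
      have h3 : q (f m) = a • (m : L) := rfl
      have h4 : q (u, ⟨a • u, hu a ha⟩) = a • u := rfl
      rw [map_sub, h3, h4, eq_sub_iff_add_eq, ← eq_sub_iff_add_eq'] at h2
      exact hau (h2 ▸ sub_mem h1 (Submodule.smul_mem_smul ha m.2)))
  exact ExtZero.of_retract s r hsr hW

/-! ### Derived completeness and `Ext` -/

/-- A module `A` is derived complete along `y` if each system `a j - y a (j + 1) = b j` of
equations has exactly one solution. -/
def DerivedComplete {R : Type*} [CommRing R] (y : R) (A : Type*) [AddCommGroup A] [Module R A] :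
    Prop :=
  ∀ b : ℕ → A, ∃! a : ℕ → A, ∀ j, a j - y • a (j + 1) = b j

namespace DerivedComplete

section

variable {R : Type*} [CommRing R] {y : R} {A B C : Type*} [AddCommGroup A] [Module R A]
  [AddCommGroup B] [Module R B] [AddCommGroup C] [Module R C]

theorem eq_zero (hA : DerivedComplete y A) {a : ℕ → A} (ha : ∀ j, a j = y • a (j + 1)) (j : ℕ) :
    a j = 0 :=
  congrFun ((hA 0).unique (fun j => sub_eq_zero.2 (ha j))
    (y₂ := fun _ => 0) (fun j => by simp)) j

theorem mk' (h : ∀ b : ℕ → A, ∃ a : ℕ → A, ∀ j, a j - y • a (j + 1) = b j)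
    (h0 : ∀ a : ℕ → A, (∀ j, a j = y • a (j + 1)) → ∀ j, a j = 0) : DerivedComplete y A := by
  intro b
  obtain ⟨a, ha⟩ := h b
  refine ⟨a, ha, fun a' ha' => funext fun j => sub_eq_zero.1 (h0 (a' - a) (fun j => ?_) j)⟩
  have : a' j - y • a' (j + 1) = a j - y • a (j + 1) := (ha' j).trans (ha j).symm
  rw [Pi.sub_apply, Pi.sub_apply, smul_sub, ← sub_eq_zero, sub_sub_sub_comm, this, sub_self]

/-- Solutions in `C` come from lifting to `B`. For uniqueness, lifts of a homogeneous solution fail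
the equations by elements of `f(A)`; solving the system in `A` corrects them to a homogeneous
solution in `B`, which is zero. Injectivity of `f` plays no role. -/
theorem cokernel {f : A →+ B} {g : B →+ C} (hf : ∀ a, f (y • a) = y • f a)
    (hg : ∀ b, g (y • b) = y • g b) (hfg : Function.Exact f g) (hgs : Function.Surjective g)
    (hA : DerivedComplete y A) (hB : DerivedComplete y B) : DerivedComplete y C := by
  refine mk' (fun c => ?_) (fun c hc j => ?_)
  · choose b hb using fun j => hgs (c j)
    obtain ⟨a, ha, -⟩ := hB b
    exact ⟨fun j => g (a j), fun j => by rw [← hg, ← map_sub, ha, hb]⟩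
  · choose b hb using fun j => hgs (c j)
    have h1 : ∀ j, ∃ a, f a = b j - y • b (j + 1) := fun j => by
      refine (hfg _).1 ?_
      rw [map_sub, hg, hb, hb, ← hc, sub_self]
    choose a ha using h1
    obtain ⟨a', ha', -⟩ := hA a
    have h2 : ∀ j, b j - f (a' j) = y • (b (j + 1) - f (a' (j + 1))) := fun j => by
      have := ha j
      rw [← ha', map_sub, hf] at this
      rw [smul_sub, ← sub_eq_zero, sub_sub_sub_comm, this, sub_self]
    have h3 := hB.eq_zero (a := fun j => b j - f (a' j)) h2 j
    rw [← hb, sub_eq_zero.1 h3]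
    exact (hfg _).2 ⟨_, rfl⟩

theorem of_addEquiv (e : A ≃+ B) (he : ∀ a, e (y • a) = y • e a) (hA : DerivedComplete y A) :
    DerivedComplete y B := by
  refine mk' (fun b => ?_) (fun b hb j => ?_)
  · obtain ⟨a, ha, -⟩ := hA (fun j => e.symm (b j))
    exact ⟨fun j => e (a j), fun j => by rw [← he, ← map_sub, ha, e.apply_symm_apply]⟩
  · have := hA.eq_zero (a := fun j => e.symm (b j)) (fun j => by
      apply e.injective; rw [he, e.apply_symm_apply, e.apply_symm_apply, ← hb]) j
    simpa using this

/-- Solve pointwise; uniqueness makes the solutions linear. -/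
theorem linearMap (hA : DerivedComplete y A) : DerivedComplete y (B →ₗ[R] A) := by
  refine mk' (fun b => ?_) (fun a ha j => ?_)
  · choose s hs hu using fun x : B => hA (fun j => b j x)
    have hadd : ∀ j x x', s (x + x') j = s x j + s x' j := fun j x x' => (congrFun (hu (x + x') (s x + s x') fun j => by
        rw [map_add, ← hs, ← hs, Pi.add_apply, Pi.add_apply, smul_add, add_sub_add_comm]) j).symm
    have hsmul : ∀ j (r : R) x, s (r • x) j = r • s x j := fun j r x => (congrFun (hu (r • x) (r • s x) fun j => by
        rw [map_smul, ← hs, Pi.smul_apply, Pi.smul_apply, smul_sub, smul_comm y r]) j).symm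
    exact ⟨fun j => ⟨⟨fun x => s x j, hadd j⟩, hsmul j⟩, fun j => LinearMap.ext fun x => hs x j⟩
  · ext x
    exact hA.eq_zero (a := fun j => a j x) (fun j => by rw [ha j]; rfl) j

end

variable {R : Type u} [CommRing R] {y : R} {Q : Type u} [AddCommGroup Q] [Module R Q]

theorem ext_zero (hQ : DerivedComplete y Q) (W : Type u) [AddCommGroup W] [Module R W] :
    DerivedComplete y (Ext (ModuleCat.of R W) (ModuleCat.of R Q) 0) := by
  refine of_addEquiv (A := W →ₗ[R] Q)
    ((ModuleCat.homAddEquiv (M := ModuleCat.of R W) (N := ModuleCat.of R Q)).symm.trans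
      Ext.addEquiv₀.symm) (fun a => ?_) hQ.linearMap
  change Ext.mk₀ (y • ModuleCat.ofHom a) = _
  rw [Ext.mk₀_smul]
  rfl

/-- Dimension shifting along `0 → K → P → W → 0` with `P` projective: `Ext^(i+1)(W, Q)` is the
cokernel of `Ext^i(P, Q) → Ext^i(K, Q)`. -/
theorem ext (hQ : DerivedComplete y Q) (i : ℕ) (W : Type u) [AddCommGroup W] [Module R W] :
    DerivedComplete y (Ext (ModuleCat.of R W) (ModuleCat.of R Q) i) := by
  induction i generalizing W with
  | zero => exact hQ.ext_zero W
  | succ i ih =>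
    let S := (ModuleCat.of R W).projectiveShortComplex
    have hS : S.ShortExact := ModuleCat.shortExact_projectiveShortComplex _
    have hP : ExtZero R S.X₂ Q (i + 1) := ExtZero.of_projective i
    refine cokernel (A := Ext S.X₂ (ModuleCat.of R Q) i) (B := Ext S.X₁ (ModuleCat.of R Q) i)
      (f := (Ext.mk₀ S.f).precomp _ (zero_add i)) (g := hS.extClass.precomp _ (add_comm 1 i))
      (fun a => by simp) (fun a => by simp) (fun x => ⟨fun h => ?_, ?_⟩) (fun x => ?_)
      (ih S.X₂) (ih S.X₁)
    · exact Ext.contravariant_sequence_exact₁ hS _ x (add_comm 1 i) h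
    · rintro ⟨z, rfl⟩
      exact hS.extClass_comp_assoc z (h := add_comm 1 i)
    · exact Ext.contravariant_sequence_exact₃ hS _ x (hP.elim _ _) (add_comm 1 i)

/-- Modules on which `y` is invertible have no extensions by modules that are derived complete
along `y`. -/
theorem extZero (hQ : DerivedComplete y Q) {W : Type u} [AddCommGroup W] [Module R W]
    (hW : Function.Bijective (fun w : W => y • w)) (i : ℕ) : ExtZero R W Q i := by
  let e : W ≃ₗ[R] W := LinearEquiv.ofBijective (LinearMap.lsmul R W y) hW
  have he : y • (e.symm : W →ₗ[R] W) = LinearMap.id := by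
    ext w; exact e.apply_symm_apply w
  have hmk : y • (ModuleCat.ofHom (e.symm : W →ₗ[R] W)) = 𝟙 (ModuleCat.of R W) := by
    apply ModuleCat.hom_ext
    exact he
  refine subsingleton_of_forall_eq 0 fun x => ?_
  -- `T` inverts `y` on `Ext`, so the iterates `T^j x` solve the homogeneous system and vanish.
  let T : Ext (ModuleCat.of R W) (ModuleCat.of R Q) i → Ext (ModuleCat.of R W) (ModuleCat.of R Q) i :=
    fun x => (Ext.mk₀ (ModuleCat.ofHom (e.symm : W →ₗ[R] W))).comp x (zero_add i)
  have hT : ∀ x, x = y • T x := fun x => by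
    rw [← Ext.smul_comp, ← Ext.mk₀_smul, hmk, Ext.mk₀_id_comp]
  exact (hQ.ext i W).eq_zero (a := fun j => T^[j] x) (fun j => by
    rw [Function.iterate_succ_apply']; exact hT _) 0

end DerivedComplete

/-! ### Torsion in injective modules -/

/-- The elements of `E` killed by some power of each element of `S`. -/
def setTorsion {R : Type*} [CommRing R] (S : Set R) (E : Type*) [AddCommGroup E] [Module R E] :
    Submodule R E where
  carrier := {e | ∀ x ∈ S, ∃ k : ℕ, x ^ k • e = 0}
  add_mem' := by
    intro a b ha hb x hx
    obtain ⟨k, hk⟩ := ha x hx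
    obtain ⟨l, hl⟩ := hb x hx
    refine ⟨k + l, ?_⟩
    rw [smul_add, pow_add, mul_smul, mul_smul, hl, smul_zero, smul_comm, hk, smul_zero, add_zero]
  zero_mem' x _ := ⟨0, smul_zero _⟩
  smul_mem' r a ha x hx := by
    obtain ⟨k, hk⟩ := ha x hx
    exact ⟨k, by rw [smul_comm, hk, smul_zero]⟩

section

variable {R : Type*} [CommRing R] {S : Set R} {E F : Type*} [AddCommGroup E] [Module R E]
  [AddCommGroup F] [Module R F]

theorem map_mem_setTorsion (f : E →ₗ[R] F) {e : E} (he : e ∈ setTorsion S E) :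
    f e ∈ setTorsion S F := fun x hx => by
  obtain ⟨k, hk⟩ := he x hx
  exact ⟨k, by rw [← map_smul, hk, map_zero]⟩

/-- A nonzero torsion element has a nonzero multiple killed by a finite set. -/
theorem exists_smul_ne_zero_of_mem_setTorsion (s : Finset R) {e : E}
    (he : e ∈ setTorsion (s : Set R) E) (h0 : e ≠ 0) :
    ∃ e' : E, e' ≠ 0 ∧ ∀ x ∈ s, x • e' = 0 := by
  classical
  suffices H : ∀ t : Finset R, t ⊆ s → ∃ r : R, r • e ≠ 0 ∧ ∀ x ∈ t, x • r • e = 0 by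
    obtain ⟨r, hr, h⟩ := H s subset_rfl
    exact ⟨_, hr, h⟩
  intro t
  induction t using Finset.induction_on with
  | empty => exact fun _ => ⟨1, by simpa using h0, by simp⟩
  | insert y t _ ih =>
    intro ht
    obtain ⟨r, hr, h⟩ := ih ((Finset.subset_insert _ _).trans ht)
    have hk : ∃ k : ℕ, y ^ k • r • e = 0 := by
      obtain ⟨k, hk⟩ := he y (ht (Finset.mem_insert_self _ _))
      exact ⟨k, by rw [smul_comm, hk, smul_zero]⟩
    -- Multiplying by one power of `y` less than the least annihilating one keeps the element
    -- nonzero and makes `y` kill it.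
    have hpos : Nat.find hk ≠ 0 := fun h0 => hr (by simpa [h0] using Nat.find_spec hk)
    obtain ⟨m, hm⟩ := Nat.exists_eq_succ_of_ne_zero hpos
    refine ⟨y ^ m * r, ?_, ?_⟩
    · rw [mul_smul]
      exact Nat.find_min hk (by omega)
    · intro x hx
      rw [Finset.mem_insert] at hx
      rcases hx with rfl | hx
      · rw [mul_smul, ← mul_smul, ← pow_succ', ← Nat.succ_eq_add_one, ← hm]
        exact Nat.find_spec hk
      · rw [mul_smul, smul_comm, h x hx, smul_zero]

end

theorem Module.Injective.exists_extend {R : Type u} [CommRing R] {A B E : Type u} [AddCommGroup A]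
    [Module R A] [AddCommGroup B] [Module R B] [AddCommGroup E] [Module R E]
    [h : Module.Injective R E] (i : A →ₗ[R] B) (hi : Function.Injective i) (f : A →ₗ[R] E) :
    ∃ g : B →ₗ[R] E, g ∘ₗ i = f := by
  obtain ⟨g, hg⟩ := h.out i hi f
  exact ⟨g, LinearMap.ext hg⟩

/-- In an injective module over a Noetherian ring, elements are divisible by `y` up to `y`-power
torsion, without enlarging the annihilator. -/
theorem Module.Injective.exists_smul_sub {R : Type u} [CommRing R] [IsNoetherianRing R] {E : Type u}
    [AddCommGroup E] [Module R E] [Module.Injective R E] (y : R) (e : E) :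
    ∃ e' : E, (∀ r : R, r • e = 0 → r • e' = 0) ∧ ∃ k : ℕ, y ^ k • (y • e' - e) = 0 := by
  let I : Ideal R := LinearMap.ker (LinearMap.toSpanSingleton R E e)
  let m : Module.End R (R ⧸ I) := LinearMap.lsmul R (R ⧸ I) y
  have hmp : ∀ k c, (m ^ k) c = y ^ k • c := by
    intro k
    induction k with
    | zero => simp
    | succ k ih =>
      intro c
      rw [pow_succ', Module.End.mul_apply, ih, pow_succ', mul_smul]
      rfl
  obtain ⟨k, hk⟩ := monotone_stabilizes_iff_noetherian.2 (inferInstance : IsNoetherian R (R ⧸ I))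
    m.iterateKer
  let φ : (R ⧸ I) →ₗ[R] E := Submodule.liftQ I (LinearMap.toSpanSingleton R E e) le_rfl
  have hφ1 : φ (Submodule.Quotient.mk 1) = e := one_smul R e
  -- Since the kernels have stabilized, `y^(k+1) c ↦ y^k φ(c)` is well defined on the image of `m ^
  -- (k + 1)`. It extends to `R ⧸ I`, and `e'` is the image of 1.
  have hker : LinearMap.ker (m ^ (k + 1)) ≤ LinearMap.ker (φ ∘ₗ m ^ k) := by
    have h : LinearMap.ker (m ^ k) = LinearMap.ker (m ^ (k + 1)) := hk (k + 1) (Nat.le_succ k)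
    rw [← h]
    intro c hc
    rw [LinearMap.mem_ker] at hc ⊢
    rw [LinearMap.comp_apply, hc, map_zero]
  let ψ := Submodule.liftQ (LinearMap.ker (m ^ (k + 1))) (φ ∘ₗ m ^ k) hker
  let i : ((R ⧸ I) ⧸ LinearMap.ker (m ^ (k + 1))) →ₗ[R] (R ⧸ I) :=
    Submodule.liftQ _ (m ^ (k + 1)) le_rfl
  obtain ⟨g, hg⟩ := Module.Injective.exists_extend i
    (LinearMap.ker_eq_bot.1 (Submodule.ker_liftQ_eq_bot' _ _ rfl)) ψ
  refine ⟨g (Submodule.Quotient.mk 1), fun r hr => ?_, k, ?_⟩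
  · have h1 : r • (Submodule.Quotient.mk 1 : R ⧸ I) = 0 := by
      rw [← Submodule.Quotient.mk_smul, Submodule.Quotient.mk_eq_zero]
      change (r • (1 : R)) • e = 0
      rwa [smul_eq_mul, mul_one]
    rw [← map_smul, h1, map_zero]
  · have h2 := LinearMap.congr_fun hg (Submodule.Quotient.mk (Submodule.Quotient.mk 1))
    have h3 : g ((m ^ (k + 1)) (Submodule.Quotient.mk 1)) =
      φ ((m ^ k) (Submodule.Quotient.mk 1)) := h2
    rw [hmp, hmp, map_smul, map_smul, hφ1] at h3
    rw [smul_sub, ← mul_smul, ← pow_succ, h3, sub_self]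

/-- For an injective module `E`, the quotient by the torsion along a finite set has no extensions by
modules that are derived complete along the elements of that set. -/
theorem DerivedComplete.extZero_quotient_setTorsion {R : Type u} [CommRing R] [IsNoetherianRing R]
    {E Q : Type u} [AddCommGroup E] [Module R E] [Module.Injective R E] [AddCommGroup Q]
    [Module R Q] (s : Finset R) (hQ : ∀ y ∈ s, DerivedComplete y Q) (i : ℕ) :
    ExtZero R (E ⧸ setTorsion (s : Set R) E) Q i := by
  classical
  induction s using Finset.induction_on with
  | empty =>
    have h : setTorsion ((∅ : Finset R) : Set R) E = ⊤ :=
      eq_top_iff.2 fun e _ x hx => absurd hx (by simp)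
    have : Subsingleton (E ⧸ setTorsion ((∅ : Finset R) : Set R) E) :=
      Submodule.Quotient.subsingleton_iff.2 h
    exact ExtZero.of_subsingleton i
  | insert y s _ ih =>
    have hle : setTorsion ((insert y s : Finset R) : Set R) E ≤ setTorsion (s : Set R) E :=
      fun e he x hx => he x (Finset.mem_insert_of_mem hx)
    let p := Submodule.factor hle
    have hp : Function.Surjective p := Submodule.factor_surjective hle
    refine ExtZero.middle (f := (LinearMap.ker p).subtype) (g := p) Subtype.val_injective
      (fun x => by simp) hp ?_ (ih fun y hy => hQ y (Finset.mem_insert_of_mem hy))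
    -- The kernel of `p` is the `s`-torsion modulo the torsion along `s ∪ {y}`, and `y` is bijective
    -- on it. For surjectivity the annihilator bound in `exists_smul_sub` keeps `e'` in the
    -- `s`-torsion.
    refine (hQ y (Finset.mem_insert_self _ _)).extZero ⟨?_, ?_⟩ i
    · change Function.Injective (LinearMap.lsmul R (LinearMap.ker p) y)
      rw [injective_iff_map_eq_zero]
      rintro ⟨c, hc⟩ h
      obtain ⟨e, rfl⟩ := Submodule.Quotient.mk_surjective _ c
      have he : e ∈ setTorsion (s : Set R) E := (Submodule.Quotient.mk_eq_zero _).1 hc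
      have h1 : y • e ∈ setTorsion ((insert y s : Finset R) : Set R) E :=
        (Submodule.Quotient.mk_eq_zero _).1 (congrArg Subtype.val h)
      refine Subtype.ext ((Submodule.Quotient.mk_eq_zero _).2 fun x hx => ?_)
      rcases Finset.mem_insert.1 hx with rfl | hx'
      · obtain ⟨k, hk⟩ := h1 x hx
        exact ⟨k + 1, by rwa [pow_succ, mul_smul]⟩
      · exact he x hx'
    · rintro ⟨c, hc⟩
      obtain ⟨e, rfl⟩ := Submodule.Quotient.mk_surjective _ c
      have he : e ∈ setTorsion (s : Set R) E := (Submodule.Quotient.mk_eq_zero _).1 hc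
      obtain ⟨e', he', k, hk⟩ := Module.Injective.exists_smul_sub y e
      have he's : e' ∈ setTorsion (s : Set R) E := fun x hx => by
        obtain ⟨l, hl⟩ := he x hx
        exact ⟨l, he' _ hl⟩
      refine ⟨⟨Submodule.Quotient.mk e', (Submodule.Quotient.mk_eq_zero _).2 he's⟩, Subtype.ext ?_⟩
      refine (Submodule.Quotient.eq _).2 fun x hx => ?_
      rcases Finset.mem_insert.1 hx with rfl | hx'
      · exact ⟨k, hk⟩
      · exact Submodule.sub_mem _ (Submodule.smul_mem _ y he's) he x hx'

/-! ### Degree lowering maps on an injective resolution -/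

theorem Module.Injective.exists_factor {R : Type u} [CommRing R] {A B C E : Type u}
    [AddCommGroup A] [Module R A] [AddCommGroup B] [Module R B] [AddCommGroup C] [Module R C]
    [AddCommGroup E] [Module R E] [Module.Injective R E] {f : A →ₗ[R] B} {h : B →ₗ[R] C}
    (hfh : Function.Exact f h) (g : B →ₗ[R] E) (hg : g ∘ₗ f = 0) : ∃ k : C →ₗ[R] E, k ∘ₗ h = g := by
  have hle : LinearMap.ker h ≤ LinearMap.ker g := fun b hb => by
    obtain ⟨a, rfl⟩ := (hfh b).1 hb
    exact LinearMap.congr_fun hg a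
  obtain ⟨k, hk⟩ := Module.Injective.exists_extend (Submodule.liftQ (LinearMap.ker h) h le_rfl)
    (LinearMap.ker_eq_bot.1 (Submodule.ker_liftQ_eq_bot' _ _ rfl))
    (Submodule.liftQ (LinearMap.ker h) g hle)
  exact ⟨k, LinearMap.ext fun b => LinearMap.congr_fun hk (Submodule.Quotient.mk b)⟩

section

variable {R : Type u} [CommRing R] {I : ℕ → Type u} [∀ i, AddCommGroup (I i)]
  [∀ i, Module R (I i)] [∀ i, Module.Injective R (I i)] {d : ∀ i, I i →ₗ[R] I (i + 1)} {S : Set R}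

/-- A degree lowering family of maps on an injective resolution, given by one component `g` that can
be continued downwards, is null homotopic up to a map vanishing on socles. -/
theorem exists_homotopy (hd : ∀ i, Function.Exact (d i) (d (i + 1)))
    (hsoc : ∀ i (z : I i), (∀ r ∈ S, r • z = 0) → d i z = 0)
    (hV0 : ∀ i (f : (I i ⧸ setTorsion S (I i)) →ₗ[R] I 0), d 0 ∘ₗ f = 0 → f = 0)
    (hV : ∀ i j (f : (I i ⧸ setTorsion S (I i)) →ₗ[R] I (j + 1)), d (j + 1) ∘ₗ f = 0 →
      ∃ h : (I i ⧸ setTorsion S (I i)) →ₗ[R] I j, d j ∘ₗ h = f)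
    (t j : ℕ) (g : I (t + j + 1) →ₗ[R] I j)
    (hg : setTorsion S (I (t + j)) ≤ LinearMap.ker (g ∘ₗ d (t + j)))
    (hgd : d j ∘ₗ g ∘ₗ d (t + j) = 0) :
    ∃ (k : I (t + j + 1 + 1) →ₗ[R] I j) (y : I (t + j + 1) →ₗ[R] I j),
      g = k ∘ₗ d (t + j + 1) + y ∧ d j ∘ₗ y = 0 ∧ ∀ z, (∀ r ∈ S, r • z = 0) → y z = 0 := by
  induction j with
  | zero =>
    have h0 := hV0 (t + 0) (Submodule.liftQ _ _ hg) (by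
      ext z; exact LinearMap.congr_fun hgd z)
    have h1 : g ∘ₗ d (t + 0) = 0 := by
      rw [← Submodule.liftQ_mkQ _ _ hg, h0, LinearMap.zero_comp]
    obtain ⟨k, hk⟩ := Module.Injective.exists_factor (hd (t + 0)) g h1
    exact ⟨k, 0, hk.symm.trans (add_zero _).symm, LinearMap.comp_zero _, fun _ _ => rfl⟩
  | succ j ih =>
    -- The composite `g ∘ d` factors through the torsion-free quotient, where `Hom(V, I)` is exact;
    -- lifting it gives the next component `g'` down, which kills torsion.
    obtain ⟨h, hh⟩ := hV (t + (j + 1)) j (Submodule.liftQ _ _ hg) (by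
      ext z; exact LinearMap.congr_fun hgd z)
    let g' : I (t + j + 1) →ₗ[R] I j := h ∘ₗ Submodule.mkQ _
    have hg' : d j ∘ₗ g' = g ∘ₗ d (t + (j + 1)) := by
      rw [← LinearMap.comp_assoc, hh, Submodule.liftQ_mkQ]
    obtain ⟨k', y', hky, hy, -⟩ := ih g' (fun z hz => by
        have h1 := map_mem_setTorsion (d (t + j)) hz
        change h (Submodule.Quotient.mk (d (t + j) z)) = 0
        rw [(Submodule.Quotient.mk_eq_zero _).2 h1, map_zero]) (by
        rw [← LinearMap.comp_assoc, hg', LinearMap.comp_assoc]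
        exact (congrArg (g.comp ·) (hd (t + j)).linearMap_comp_eq_zero).trans
          (LinearMap.comp_zero _))
    -- With `k'` the homotopy one degree lower, `g - d k'` vanishes on the image of `d`, so it
    -- factors through the next differential.
    obtain ⟨k, hk⟩ := Module.Injective.exists_factor (hd (t + (j + 1))) (g - d j ∘ₗ k') (by
      ext z
      have h1 := LinearMap.congr_fun hg' z
      have h2 := LinearMap.congr_fun hy z
      have h3 := LinearMap.congr_fun hky z
      simp only [LinearMap.comp_apply, LinearMap.sub_apply, LinearMap.add_apply,
        LinearMap.zero_apply] at h1 h2 h3 ⊢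
      rw [← h1, h3, map_add, h2, add_zero]
      exact sub_self _)
    refine ⟨k, d j ∘ₗ k', by rw [hk, sub_add_cancel], ?_, fun z hz => ?_⟩
    · rw [← LinearMap.comp_assoc, (hd j).linearMap_comp_eq_zero, LinearMap.zero_comp]
    · exact hsoc j _ fun r hr => by rw [← map_smul, hz r hr, map_zero]

/-- As `I (a + 1)` has no torsion, `d ∘ g` factors through the torsion-free quotient and lifts along
`d a`. Subtracting the lift makes `d ∘ g = 0` without changing `g` on socles. `exists_homotopy` then
applies, because `I (t + a)` has no torsion. -/
theorem map_socle_eq_zero (hd : ∀ i, Function.Exact (d i) (d (i + 1)))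
    (hsoc : ∀ i (z : I i), (∀ r ∈ S, r • z = 0) → d i z = 0)
    (hV0 : ∀ i (f : (I i ⧸ setTorsion S (I i)) →ₗ[R] I 0), d 0 ∘ₗ f = 0 → f = 0)
    (hV : ∀ i j (f : (I i ⧸ setTorsion S (I i)) →ₗ[R] I (j + 1)), d (j + 1) ∘ₗ f = 0 →
      ∃ h : (I i ⧸ setTorsion S (I i)) →ₗ[R] I j, d j ∘ₗ h = f)
    {t a : ℕ} (ha : setTorsion S (I (a + 1)) = ⊥) (ht : setTorsion S (I (t + a)) = ⊥)
    (g : I (t + a + 1) →ₗ[R] I a) {z : I (t + a + 1)} (hz : ∀ r ∈ S, r • z = 0) : g z = 0 := by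
  have hdg : setTorsion S (I (t + a + 1)) ≤ LinearMap.ker (d a ∘ₗ g) := fun z hz => by
    have := map_mem_setTorsion (d a ∘ₗ g) hz
    rwa [ha, Submodule.mem_bot] at this
  obtain ⟨h, hh⟩ := hV (t + a + 1) a (Submodule.liftQ _ _ hdg) (by
    ext z
    exact LinearMap.congr_fun (hd a).linearMap_comp_eq_zero (g z))
  have hdg0 : d a ∘ₗ (g - h ∘ₗ Submodule.mkQ _) = 0 := by
    rw [LinearMap.comp_sub, ← LinearMap.comp_assoc, hh, Submodule.liftQ_mkQ, sub_self]
  obtain ⟨k, y, hky, -, hy⟩ := exists_homotopy hd hsoc hV0 hV t a (g - h ∘ₗ Submodule.mkQ _)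
    (by rw [ht]; exact bot_le)
    (by rw [← LinearMap.comp_assoc, hdg0, LinearMap.zero_comp])
  have hzt : z ∈ setTorsion S (I (t + a + 1)) := fun r hr => ⟨1, by rw [pow_one, hz r hr]⟩
  have h1 := LinearMap.congr_fun hky z
  simp only [LinearMap.comp_apply, LinearMap.sub_apply, LinearMap.add_apply, hy z hz, hsoc _ z hz,
    map_zero, add_zero, Submodule.mkQ_apply, (Submodule.Quotient.mk_eq_zero _).2 hzt,
    sub_zero] at h1
  exact h1

end

/-! ### Injective hulls and the minimal injective resolution -/

section Hull

variable {R : Type u} [CommRing R]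

theorem Module.Injective.of_retract {A E : Type u} [AddCommGroup A] [Module R A] [AddCommGroup E]
    [Module R E] [Module.Injective R E] (s : A →ₗ[R] E) (r : E →ₗ[R] A)
    (h : ∀ a, r (s a) = a) : Module.Injective R A := by
  refine ⟨fun X Y _ _ _ _ f hf g => ?_⟩
  obtain ⟨k, hk⟩ := Module.Injective.exists_extend f hf (s ∘ₗ g)
  exact ⟨r ∘ₗ k, fun x => (congrArg r (LinearMap.congr_fun hk x)).trans (h _)⟩

/-- Existence of injective hulls: each module has an essential embedding into an injective module. -/
theorem ModuleCat.exists_injective_hull (Z : ModuleCat.{u} R) :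
    ∃ (E : ModuleCat.{u} R) (ι : Z →ₗ[R] E), Module.Injective R E ∧ Function.Injective ι ∧
      ∀ C : Submodule R E, Disjoint C (LinearMap.range ι) → C = ⊥ := by
  obtain ⟨E₀, hE₀, ι₀, hι₀⟩ := EnoughInjectives.presentation Z
  have : Module.Injective R E₀ := Module.injective_module_of_injective_object R E₀
  have hι₀ : Function.Injective ι₀.hom := (ModuleCat.mono_iff_injective _).1 hι₀
  -- `E` is a maximal essential extension of `Z₀` in `E₀`, and `D` a maximal submodule meeting `E`
  -- trivially.
  let Z₀ := LinearMap.range ι₀.hom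
  obtain ⟨E, hZE, hE⟩ := zorn_le_nonempty₀
    {E : Submodule R E₀ | ∀ C ≤ E, Disjoint C Z₀ → C = ⊥} (fun c hc hch E₁ hE₁ => by
      refine ⟨sSup c, fun C hC hCZ => ?_, fun _ => le_sSup⟩
      rw [eq_bot_iff]
      intro x hx
      obtain ⟨E, hE, hxE⟩ := (Submodule.mem_sSup_of_directed ⟨E₁, hE₁⟩ hch.directedOn).1 (hC hx)
      have hle : Submodule.span R {x} ≤ C := by simpa using hx
      have := hc hE (Submodule.span R {x}) (by simpa using hxE) (hCZ.mono_left hle)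
      exact Submodule.span_singleton_eq_bot.1 this) Z₀ (fun C hC h => h.eq_bot_of_le hC)
  obtain ⟨D, -, hD⟩ := zorn_le_nonempty₀ {D : Submodule R E₀ | Disjoint D E}
    (fun c hc hch D₁ hD₁ => by
      refine ⟨sSup c, ?_, fun _ => le_sSup⟩
      rw [Set.mem_ofPred_eq, Submodule.disjoint_def]
      intro x hx hxE
      obtain ⟨D, hD, hxD⟩ := (Submodule.mem_sSup_of_directed ⟨D₁, hD₁⟩ hch.directedOn).1 hx
      exact Submodule.disjoint_def.1 (hc hD) x hxD hxE) ⊥ disjoint_bot_left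
  obtain ⟨g, hg⟩ := Module.Injective.exists_extend (D.mkQ ∘ₗ E.subtype) (by
    rw [injective_iff_map_eq_zero]
    rintro ⟨x, hx⟩ h
    exact Subtype.ext (Submodule.disjoint_def.1 hD.1 x ((Submodule.Quotient.mk_eq_zero _).1 h) hx))
    E.subtype
  have hgE : ∀ x ∈ E, g (D.mkQ x) = x := fun x hx => LinearMap.congr_fun hg ⟨x, hx⟩
  have hEg : E ≤ LinearMap.range g := fun x hx => ⟨_, hgE x hx⟩
  -- The range of `g` is again essential over `Z₀`: if `C` in it misses `Z₀`, its preimage contains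
  -- `D` and misses `E`, so it equals `D` and `C = 0`. Maximality of `E` makes `g` a retraction onto
  -- `E`.
  have hgmem : LinearMap.range g ≤ E := by
    refine hE.2 (fun C hC hCZ => ?_) hEg
    have hCE : C ⊓ E = ⊥ := hE.1 _ inf_le_right (hCZ.mono_left inf_le_left)
    have hDC : D ≤ C.comap (g ∘ₗ D.mkQ) := fun x hx => by
      rw [Submodule.mem_comap, LinearMap.comp_apply, Submodule.mkQ_apply,
        (Submodule.Quotient.mk_eq_zero _).2 hx, map_zero]
      exact C.zero_mem
    have hCD : C.comap (g ∘ₗ D.mkQ) ≤ D := hD.2 (Submodule.disjoint_def.2 fun x hx hxE => by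
      have h1 : g (D.mkQ x) ∈ C := hx
      rw [hgE x hxE] at h1
      have h2 : x ∈ C ⊓ E := ⟨h1, hxE⟩
      rwa [hCE] at h2) hDC
    rw [eq_bot_iff]
    intro x hx
    obtain ⟨y, rfl⟩ := hC hx
    obtain ⟨y, rfl⟩ := D.mkQ_surjective y
    have : y ∈ D := hCD hx
    rw [Submodule.mkQ_apply, (Submodule.Quotient.mk_eq_zero _).2 this, map_zero]
    exact Submodule.zero_mem _
  refine ⟨ModuleCat.of R E, ι₀.hom.codRestrict E fun z => hZE ⟨z, rfl⟩,
    Module.Injective.of_retract E.subtype ((g ∘ₗ D.mkQ).codRestrict E fun x => hgmem ⟨_, rfl⟩)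
      fun x => Subtype.ext (hgE x x.2), fun x y h => hι₀ (congrArg Subtype.val h), fun C hC => ?_⟩
  have h1 : C.map E.subtype = ⊥ := by
    refine hE.1 _ (Submodule.map_subtype_le E C) (Submodule.disjoint_def.2 ?_)
    rintro _ ⟨x, hx, rfl⟩ ⟨z, hz⟩
    exact congrArg Subtype.val (Submodule.disjoint_def.1 hC x hx ⟨z, Subtype.ext hz⟩)
  exact Submodule.map_injective_of_injective (f := E.subtype) Subtype.val_injective
    (h1.trans (Submodule.map_bot _).symm)

end Hull

namespace ModuleCat

variable {R : Type u} [CommRing R]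

/-- The injective hull of a module. -/
noncomputable def injHull (Z : ModuleCat.{u} R) : ModuleCat.{u} R :=
  (exists_injective_hull Z).choose

/-- The embedding of a module into its injective hull. -/
noncomputable def toInjHull (Z : ModuleCat.{u} R) : Z →ₗ[R] injHull Z :=
  (exists_injective_hull Z).choose_spec.choose

instance (Z : ModuleCat.{u} R) : Module.Injective R (injHull Z) :=
  (exists_injective_hull Z).choose_spec.choose_spec.1

theorem toInjHull_injective (Z : ModuleCat.{u} R) : Function.Injective (toInjHull Z) :=
  (exists_injective_hull Z).choose_spec.choose_spec.2.1

theorem eq_bot_of_disjoint_range_toInjHull {Z : ModuleCat.{u} R} {C : Submodule R (injHull Z)}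
    (h : Disjoint C (LinearMap.range (toInjHull Z))) : C = ⊥ :=
  (exists_injective_hull Z).choose_spec.choose_spec.2.2 C h

/-- The cosyzygies in the minimal injective resolution of a module. -/
noncomputable def cosyzygy (Q : ModuleCat.{u} R) : ℕ → ModuleCat.{u} R
  | 0 => Q
  | i + 1 => ModuleCat.of R (injHull (cosyzygy Q i) ⧸ LinearMap.range (toInjHull (cosyzygy Q i)))

/-- The modules in the minimal injective resolution of a module. -/
noncomputable abbrev minInj (Q : ModuleCat.{u} R) (i : ℕ) : ModuleCat.{u} R :=
  injHull (cosyzygy Q i)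

variable (Q : ModuleCat.{u} R)

/-- The quotient map from the minimal injective resolution to the next cosyzygy. -/
noncomputable def toCosyzygy (i : ℕ) : minInj Q i →ₗ[R] cosyzygy Q (i + 1) :=
  (LinearMap.range (toInjHull (cosyzygy Q i))).mkQ

theorem toCosyzygy_surjective (i : ℕ) : Function.Surjective (toCosyzygy Q i) :=
  Submodule.mkQ_surjective _

theorem exact_toInjHull_toCosyzygy (i : ℕ) :
    Function.Exact (toInjHull (cosyzygy Q i)) (toCosyzygy Q i) :=
  LinearMap.exact_map_mkQ_range _

/-- The differentials of the minimal injective resolution of a module. -/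
noncomputable def minInjD (i : ℕ) : minInj Q i →ₗ[R] minInj Q (i + 1) :=
  toInjHull (cosyzygy Q (i + 1)) ∘ₗ toCosyzygy Q i

theorem exact_minInjD (i : ℕ) : Function.Exact (minInjD Q i) (minInjD Q (i + 1)) := by
  intro x
  constructor
  · intro h
    have h1 : toCosyzygy Q (i + 1) x = 0 :=
      toInjHull_injective _ (h.trans (map_zero _).symm)
    obtain ⟨z, rfl⟩ := (exact_toInjHull_toCosyzygy Q (i + 1) x).1 h1
    obtain ⟨y, rfl⟩ := toCosyzygy_surjective Q i z
    exact ⟨y, rfl⟩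
  · rintro ⟨y, rfl⟩
    have h1 : toCosyzygy Q (i + 1) (toInjHull _ (toCosyzygy Q i y)) = 0 :=
      (exact_toInjHull_toCosyzygy Q (i + 1) _).2 ⟨_, rfl⟩
    exact (congrArg (toInjHull _) h1).trans (map_zero _)

section Ext

variable {Q} (V : Type u) [AddCommGroup V] [Module R V]

/-- Degree 0 is left out: `Hom(V, -)` of an injective term need not vanish. -/
theorem extZero_cosyzygy (h : ∀ i, ExtZero R V Q i) (i j : ℕ) :
    ExtZero R V (cosyzygy Q j) (i + 1) := by
  induction j generalizing i with
  | zero => exact h (i + 1)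
  | succ j ih =>
    exact ExtZero.target_third (toInjHull_injective _) (exact_toInjHull_toCosyzygy Q j)
      (toCosyzygy_surjective Q j) (ih (i + 1)) (ExtZero.of_injective i)

variable {V} in
theorem exists_factor_cosyzygy {j : ℕ} (f : V →ₗ[R] minInj Q j) (hf : minInjD Q j ∘ₗ f = 0) :
    ∃ φ : V →ₗ[R] cosyzygy Q j, toInjHull _ ∘ₗ φ = f := by
  have h (v : V) : ∃ z, toInjHull _ z = f v := by
    refine (exact_toInjHull_toCosyzygy Q j (f v)).1 (toInjHull_injective _ ?_)
    rw [map_zero]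
    exact LinearMap.congr_fun hf v
  let e := LinearEquiv.ofInjective (toInjHull (cosyzygy Q j)) (toInjHull_injective _)
  refine ⟨e.symm.toLinearMap ∘ₗ f.codRestrict _ h, LinearMap.ext fun v => ?_⟩
  exact congrArg Subtype.val (e.apply_symm_apply (f.codRestrict _ h v))

variable {V} in
theorem eq_zero_of_minInjD_comp (h : ∀ i, ExtZero R V Q i) (f : V →ₗ[R] minInj Q 0)
    (hf : minInjD Q 0 ∘ₗ f = 0) : f = 0 := by
  obtain ⟨φ, rfl⟩ := exists_factor_cosyzygy f hf
  have h0 : φ = 0 := ExtZero.zero_iff.1 (h 0) φ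
  rw [h0, LinearMap.comp_zero]

variable {V} in
theorem exists_lift_of_minInjD_comp (h : ∀ i, ExtZero R V Q i) {j : ℕ}
    (f : V →ₗ[R] minInj Q (j + 1)) (hf : minInjD Q (j + 1) ∘ₗ f = 0) :
    ∃ g : V →ₗ[R] minInj Q j, minInjD Q j ∘ₗ g = f := by
  obtain ⟨φ, rfl⟩ := exists_factor_cosyzygy f hf
  obtain ⟨g, hg⟩ := ExtZero.exists_lift (toInjHull_injective _) (exact_toInjHull_toCosyzygy Q j)
    (toCosyzygy_surjective Q j) (extZero_cosyzygy V h 0 j) φ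
  exact ⟨g, by rw [minInjD, LinearMap.comp_assoc, hg]⟩

end Ext

/-! ### Bass numbers and socles -/

variable {Q} [IsLocalRing R]

/-- A line spanned by a socle element lies in `Z` or misses it, and the latter is excluded by
essentiality. -/
theorem mem_range_toInjHull_of_socle {Z : ModuleCat.{u} R} {z : injHull Z}
    (hz : ∀ r ∈ maximalIdeal R, r • z = 0) : z ∈ LinearMap.range (toInjHull Z) := by
  by_contra hne
  have h : Submodule.span R {z} = ⊥ := eq_bot_of_disjoint_range_toInjHull <| by
    rw [Submodule.disjoint_def]
    intro x hx hxZ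
    obtain ⟨r, rfl⟩ := Submodule.mem_span_singleton.1 hx
    by_cases hr : r ∈ maximalIdeal R
    · exact hz r hr
    · have hu : IsUnit r := by simpa using hr
      exact absurd ((Submodule.smul_mem_iff_of_isUnit _ hu).1 hxZ) hne
  rw [Submodule.span_singleton_eq_bot] at h
  exact hne (h ▸ Submodule.zero_mem _)

theorem minInjD_socle {i : ℕ} {z : minInj Q i} (hz : ∀ r ∈ maximalIdeal R, r • z = 0) :
    minInjD Q i z = 0 := by
  have : toCosyzygy Q i z = 0 :=
    (exact_toInjHull_toCosyzygy Q i z).2 (mem_range_toInjHull_of_socle hz)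
  rw [minInjD, LinearMap.comp_apply, this, map_zero]

theorem extZero_residue_zero_iff (E : Type u) [AddCommGroup E] [Module R E] :
    ExtZero R (R ⧸ maximalIdeal R) E 0 ↔ ∀ z : E, (∀ r ∈ maximalIdeal R, r • z = 0) → z = 0 := by
  rw [ExtZero.zero_iff]
  constructor
  · intro h z hz
    have := LinearMap.congr_fun (h (Submodule.liftQ _ (LinearMap.toSpanSingleton R E z)
      fun r hr => hz r hr)) (Submodule.Quotient.mk 1)
    exact (one_smul R z).symm.trans this
  · intro h f
    ext
    refine h _ fun r hr => ?_
    have h1 : r • (Submodule.Quotient.mk 1 : R ⧸ maximalIdeal R) = 0 := by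
      rw [← Submodule.Quotient.mk_smul, Submodule.Quotient.mk_eq_zero, smul_eq_mul, mul_one]
      exact hr
    exact (map_smul f r _).symm.trans ((congrArg f h1).trans (map_zero f))

/-- For `i = 0` minimality is what matters: maps from `k` to the hull land in the cosyzygy `j`, so
they die in the next one. -/
theorem extZero_residue_cosyzygy_iff (i j : ℕ) :
    ExtZero R (R ⧸ maximalIdeal R) (cosyzygy Q j) (i + 1) ↔
      ExtZero R (R ⧸ maximalIdeal R) (cosyzygy Q (j + 1)) i := by
  cases i with
  | succ i =>
    exact ⟨fun h => ExtZero.target_third (toInjHull_injective _) (exact_toInjHull_toCosyzygy Q j)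
      (toCosyzygy_surjective Q j) h (ExtZero.of_injective i),
      fun h => ExtZero.target_first (toInjHull_injective _) (exact_toInjHull_toCosyzygy Q j)
      (toCosyzygy_surjective Q j) (ExtZero.of_injective (i + 1)) h⟩
  | zero =>
    refine ⟨fun h => ExtZero.zero_iff.2 fun φ => ?_, fun h =>
      ExtZero.one_of_forall_lift (toInjHull_injective _) (exact_toInjHull_toCosyzygy Q j)
      (toCosyzygy_surjective Q j) (ExtZero.of_injective 0) fun φ =>
        ⟨0, by rw [LinearMap.comp_zero, ExtZero.zero_iff.1 h φ]⟩⟩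
    obtain ⟨ψ, rfl⟩ := ExtZero.exists_lift (toInjHull_injective _) (exact_toInjHull_toCosyzygy Q j)
      (toCosyzygy_surjective Q j) h φ
    refine LinearMap.ext fun c => (exact_toInjHull_toCosyzygy Q j _).2 ?_
    refine mem_range_toInjHull_of_socle fun r hr => ?_
    have h1 : r • c = 0 := by
      obtain ⟨s, rfl⟩ := Submodule.Quotient.mk_surjective _ c
      rw [← Submodule.Quotient.mk_smul, Submodule.Quotient.mk_eq_zero]
      exact Ideal.mul_mem_right _ _ hr
    rw [← map_smul, h1, map_zero]

/-- Bass numbers of a module are computed by the socles of its minimal injective resolution. -/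
theorem extZero_residue_iff (i : ℕ) : ExtZero R (R ⧸ maximalIdeal R) Q i ↔
    ∀ z : minInj Q i, (∀ r ∈ maximalIdeal R, r • z = 0) → z = 0 := by
  have h (i j : ℕ) : ExtZero R (R ⧸ maximalIdeal R) (cosyzygy Q j) i ↔
      ExtZero R (R ⧸ maximalIdeal R) (cosyzygy Q (j + i)) 0 := by
    induction i generalizing j with
    | zero => rfl
    | succ i ih =>
      rw [extZero_residue_cosyzygy_iff, ih, Nat.succ_add_eq_add_succ]
  have h1 := h i 0
  rw [zero_add] at h1
  refine h1.trans ((extZero_residue_zero_iff _).trans ⟨fun H z hz => ?_, fun H z hz => ?_⟩)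
  · obtain ⟨w, rfl⟩ := mem_range_toInjHull_of_socle hz
    rw [H w fun r hr => toInjHull_injective _ (by rw [map_smul, hz r hr, map_zero]), map_zero]
  · exact toInjHull_injective _ ((H _ fun r hr => by rw [← map_smul, hz r hr, map_zero]).trans
      (map_zero _).symm)

theorem setTorsion_eq_bot {E : Type u} [AddCommGroup E] [Module R E]
    (h : ∀ z : E, (∀ r ∈ maximalIdeal R, r • z = 0) → z = 0) {s : Finset R}
    (hs : Ideal.span (s : Set R) = maximalIdeal R) : setTorsion (s : Set R) E = ⊥ := by
  rw [eq_bot_iff]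
  intro e he
  by_contra h0
  obtain ⟨e', he', hs'⟩ := exists_smul_ne_zero_of_mem_setTorsion s he h0
  refine he' (h e' fun r hr => ?_)
  rw [← hs] at hr
  have : Ideal.span (s : Set R) ≤ LinearMap.ker (LinearMap.toSpanSingleton R E e') :=
    Ideal.span_le.2 fun x hx => hs' x hx
  exact this hr

variable [IsNoetherianRing R]

/-- For a module that is derived complete along the maximal ideal, vanishing of a Bass number
strictly after a nonzero one forces all later Bass numbers to vanish. -/
theorem extZero_residue_of_derivedComplete (hQ : ∀ y ∈ maximalIdeal R, DerivedComplete y Q) {a : ℕ}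
    (ha : ¬ ExtZero R (R ⧸ maximalIdeal R) Q a) (ha' : ExtZero R (R ⧸ maximalIdeal R) Q (a + 1))
    (t : ℕ) : ExtZero R (R ⧸ maximalIdeal R) Q (t + a + 1) := by
  induction t with
  | zero => rwa [zero_add]
  | succ t ih =>
    obtain ⟨s, hs⟩ := (isNoetherianRing_iff_ideal_fg R).1 inferInstance (maximalIdeal R)
    have hsm : ∀ x ∈ s, x ∈ maximalIdeal R := fun x hx => hs ▸ Ideal.subset_span hx
    have hsoc {E : Type u} [AddCommGroup E] [Module R E] {z : E} (hz : ∀ r ∈ (s : Set R), r • z = 0) :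
        ∀ r ∈ maximalIdeal R, r • z = 0 := by
      intro r hr
      have : Ideal.span (s : Set R) ≤ LinearMap.ker (LinearMap.toSpanSingleton R E z) :=
        Ideal.span_le.2 fun x hx => hz x hx
      exact this (hs.symm ▸ hr)
    have hV (i : ℕ) : ∀ l, ExtZero R (minInj Q i ⧸ setTorsion (s : Set R) (minInj Q i)) Q l :=
      DerivedComplete.extZero_quotient_setTorsion s fun y hy => hQ y (hsm y hy)
    rw [extZero_residue_iff] at ha ha' ih ⊢
    push Not at ha
    obtain ⟨w, hw, hw0⟩ := ha
    intro z hz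
    by_contra hz0
    have hker : Ideal.span (s : Set R) = LinearMap.ker
        (LinearMap.toSpanSingleton R (minInj Q (t + 1 + a + 1)) z) := by
      refine le_antisymm (Ideal.span_le.2 fun x hx => hz x (hsm x hx)) ?_
      intro r hr
      rw [hs]
      by_contra hr'
      have hu : IsUnit r := by simpa using hr'
      exact hz0 ((hu.smul_eq_zero).1 hr)
    let i := Submodule.liftQ _ (LinearMap.toSpanSingleton R (minInj Q (t + 1 + a + 1)) z) hker.le
    let f : (R ⧸ Ideal.span (s : Set R)) →ₗ[R] minInj Q a :=
      Submodule.liftQ _ (LinearMap.toSpanSingleton R (minInj Q a) w) (by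
        rw [hs]; exact fun r hr => hw r hr)
    -- Both `z` and `w` are killed by `𝔪`, and `z` spans a copy of `k`; so `z ↦ w` extends to a map
    -- of injectives.
    obtain ⟨g, hg⟩ := Module.Injective.exists_extend i
      (LinearMap.ker_eq_bot.1 (Submodule.ker_liftQ_eq_bot' _ _ hker)) f
    have hgz : g z = w := by
      have h1 := LinearMap.congr_fun hg (Submodule.Quotient.mk 1)
      have h2 : i (Submodule.Quotient.mk 1) = z := one_smul R z
      have h3 : f (Submodule.Quotient.mk 1) = w := one_smul R w
      rwa [LinearMap.comp_apply, h2, h3] at h1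
    have ht : setTorsion (s : Set R) (minInj Q (t + 1 + a)) = ⊥ := by
      refine setTorsion_eq_bot ?_ hs
      rw [Nat.add_right_comm]
      exact ih
    exact hw0 (hgz.symm.trans (map_socle_eq_zero (I := fun i => minInj Q i) (d := minInjD Q)
      (S := (s : Set R)) (exact_minInjD Q) (fun i z hz => minInjD_socle (hsoc hz))
      (fun i f hf => eq_zero_of_minInjD_comp (hV i) f hf)
      (fun i j f hf => exists_lift_of_minInjD_comp (hV i) f hf)
      (setTorsion_eq_bot ha' hs) ht g fun r hr => hz r (hsm r hr)))

end ModuleCat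

/-! ### Completion and faithfully flat descent -/

theorem DerivedComplete.of_isAdicComplete {R A : Type*} [CommRing R] [AddCommGroup A] [Module R A]
    (I : Ideal R) [h : IsAdicComplete I A] {y : R} (hy : y ∈ I) : DerivedComplete y A := by
  have hpow (n : ℕ) (x : A) : y ^ n • x ∈ (I ^ n • ⊤ : Submodule R A) :=
    Submodule.smul_mem_smul (Ideal.pow_mem_pow hy n) trivial
  refine mk' (fun b => ?_) (fun a ha j => ?_)
  · let f (j n : ℕ) : A := ∑ k ∈ Finset.range n, y ^ k • b (j + k)
    have hf (j : ℕ) : ∃ L : A, ∀ n, f j n ≡ L [SMOD (I ^ n • ⊤ : Submodule R A)] := by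
      refine h.prec (fun {m n} hmn => ?_)
      rw [SModEq.comm, SModEq.sub_mem]
      have : f j n - f j m = ∑ k ∈ Finset.Ico m n, y ^ k • b (j + k) :=
        (Finset.sum_Ico_eq_sub _ hmn).symm
      rw [this]
      refine Submodule.sum_mem _ fun k hk => ?_
      exact Submodule.smul_mono_left (Ideal.pow_le_pow_right (Finset.mem_Ico.1 hk).1) (hpow k _)
    choose L hL using hf
    refine ⟨L, fun j => sub_eq_zero.1 (h.haus _ fun n => ?_)⟩
    rw [SModEq.zero]
    have h1 : L j - f j (n + 1) ∈ (I ^ n • ⊤ : Submodule R A) :=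
      Submodule.smul_mono_left (Ideal.pow_le_pow_right n.le_succ)
        (SModEq.sub_mem.1 (hL j (n + 1)).symm)
    have h2 : y • (f (j + 1) n - L (j + 1)) ∈ (I ^ n • ⊤ : Submodule R A) :=
      Submodule.smul_mem _ _ (SModEq.sub_mem.1 (hL (j + 1) n))
    have h3 : f j (n + 1) = b j + y • f (j + 1) n := by
      simp only [f, Finset.sum_range_succ', Finset.smul_sum, pow_zero, one_smul, add_zero]
      rw [add_comm]
      congr 1
      refine Finset.sum_congr rfl fun k _ => ?_
      rw [← mul_smul, ← pow_succ', add_assoc, add_comm 1 k]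
    have h4 := Submodule.add_mem _ h1 h2
    rw [h3, smul_sub] at h4
    convert h4 using 1
    abel
  · have h1 (n : ℕ) (j : ℕ) : a j = y ^ n • a (j + n) := by
      induction n generalizing j with
      | zero => simp
      | succ n ih => rw [ha, ih (j + 1), ← mul_smul, ← pow_succ', add_assoc, add_comm 1 n]
    refine h.haus _ fun n => ?_
    rw [SModEq.zero, h1 n j]
    exact hpow n _

section Flat

open TensorProduct

variable {R : Type u} [CommRing R]

/-- Over a Noetherian ring, vanishing of `Ext^i(C, N)` for a finite module `C` is the exactness of a
complex of finite direct sums of copies of `N`. -/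
theorem ExtZero.exists_iff_exact [IsNoetherianRing R] (C : Type u) [AddCommGroup C] [Module R C]
    [Module.Finite R C] (i : ℕ) :
    ∃ (a b c : ℕ) (f : (Fin c → R) →ₗ[R] (Fin b → R)) (g : (Fin b → R) →ₗ[R] (Fin a → R)),
      ∀ (N : Type u) [AddCommGroup N] [Module R N], ExtZero R C N i ↔
        Function.Exact (LinearMap.lcomp R N g) (LinearMap.lcomp R N f) := by
  have hcover (C : Type u) [AddCommGroup C] [Module R C] [Module.Finite R C] :
      ∃ (n : ℕ) (p : (Fin n → R) →ₗ[R] C), Function.Surjective p := Module.Finite.exists_fin' R C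
  have hsurj {A B N : Type u} [AddCommGroup A] [Module R A] [AddCommGroup B] [Module R B]
      [AddCommGroup N] [Module R N] {c : ℕ} (p : A →ₗ[R] B) (hp : Function.Surjective p)
      (q : (Fin c → R) →ₗ[R] LinearMap.ker p) (hq : Function.Surjective q) (φ : A →ₗ[R] N) :
      φ ∘ₗ (LinearMap.ker p).subtype ∘ₗ q = 0 ↔ ∃ ψ : B →ₗ[R] N, ψ ∘ₗ p = φ := by
    constructor
    · intro h
      have hle : LinearMap.ker p ≤ LinearMap.ker φ := fun x hx => by
        obtain ⟨y, hy⟩ := hq ⟨x, hx⟩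
        have := LinearMap.congr_fun h y
        simp only [LinearMap.comp_apply, hy] at this
        exact this
      refine ⟨(LinearMap.ker p).liftQ φ hle ∘ₗ (p.quotKerEquivOfSurjective hp).symm.toLinearMap,
        LinearMap.ext fun x => ?_⟩
      have : (p.quotKerEquivOfSurjective hp).symm (p x) = Submodule.Quotient.mk x := by
        rw [LinearEquiv.symm_apply_eq]; rfl
      simp only [LinearMap.comp_apply, LinearEquiv.coe_coe, this]
      rfl
    · rintro ⟨ψ, rfl⟩
      ext1 x
      ext
      simp
  have hex {A B : Type u} [AddCommGroup A] [Module R A] [AddCommGroup B] [Module R B]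
      (p : A →ₗ[R] B) : Function.Exact (LinearMap.ker p).subtype p := fun x => by simp
  induction i generalizing C with
  | zero =>
    obtain ⟨b, p, hp⟩ := hcover C
    obtain ⟨c, q, hq⟩ := hcover (LinearMap.ker p)
    refine ⟨0, b, c, (LinearMap.ker p).subtype ∘ₗ q, 0, fun N _ _ => ?_⟩
    rw [ExtZero.zero_iff]
    constructor
    · intro h φ
      constructor
      · intro hφ
        obtain ⟨ψ, rfl⟩ := (hsurj p hp q hq φ).1 hφ
        exact ⟨0, by rw [map_zero, h ψ, LinearMap.zero_comp]⟩
      · rintro ⟨χ, rfl⟩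
        exact LinearMap.ext fun x => map_zero χ
    · intro h ψ
      obtain ⟨χ, hχ⟩ := (h (ψ ∘ₗ p)).1 ((hsurj p hp q hq _).2 ⟨ψ, rfl⟩)
      ext x
      obtain ⟨y, rfl⟩ := hp x
      have := LinearMap.congr_fun hχ y
      exact this.symm.trans (map_zero χ)
  | succ i ih =>
    obtain ⟨a, p, hp⟩ := hcover C
    -- The shift `Ext^(i+1)(C, N) = Ext^i(ker p, N)` needs `i ≥ 1`, so degree 1 is treated directly.
    cases i with
    | zero =>
      obtain ⟨b, q, hq⟩ := hcover (LinearMap.ker p)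
      obtain ⟨c, r, hr⟩ := hcover (LinearMap.ker q)
      refine ⟨a, b, c, (LinearMap.ker q).subtype ∘ₗ r, (LinearMap.ker p).subtype ∘ₗ q,
        fun N _ _ => ⟨fun h φ => ?_, fun h => ?_⟩⟩
      · refine (hsurj q hq r hr φ).trans ⟨?_, ?_⟩
        · rintro ⟨ψ, rfl⟩
          obtain ⟨χ, rfl⟩ := ExtZero.exists_extend Subtype.val_injective (hex p) hp h ψ
          exact ⟨χ, rfl⟩
        · rintro ⟨χ, rfl⟩
          exact ⟨χ ∘ₗ (LinearMap.ker p).subtype, rfl⟩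
      · refine ExtZero.one_of_forall_extend Subtype.val_injective (hex p) hp
          (ExtZero.of_projective 0) fun φ => ?_
        obtain ⟨χ, hχ⟩ := (h (φ ∘ₗ q)).1 ((hsurj q hq r hr _).2 ⟨φ, rfl⟩)
        refine ⟨χ, LinearMap.ext fun x => ?_⟩
        obtain ⟨y, rfl⟩ := hq x
        exact LinearMap.congr_fun hχ y
    | succ i =>
      obtain ⟨a', b, c, f, g, h⟩ := ih (LinearMap.ker p)
      refine ⟨a', b, c, f, g, fun N _ _ => Iff.trans ⟨fun H => ?_, fun H => ?_⟩ (h N)⟩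
      · exact ExtZero.first Subtype.val_injective (hex p) hp (ExtZero.of_projective i) H
      · exact ExtZero.third Subtype.val_injective (hex p) hp H (ExtZero.of_projective (i + 1))

/-- `Hom` out of a finite free module commutes with `F ⊗ -`, which preserves and reflects exactness.
-/
theorem ExtZero.iff_tensor_of_faithfullyFlat [IsNoetherianRing R] (C N F : Type u) [AddCommGroup C]
    [Module R C] [Module.Finite R C] [AddCommGroup N] [Module R N] [AddCommGroup F] [Module R F]
    [Module.FaithfullyFlat R F] (i : ℕ) : ExtZero R C N i ↔ ExtZero R C (F ⊗[R] N) i := by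
  obtain ⟨a, b, c, f, g, h⟩ := ExtZero.exists_iff_exact (R := R) C i
  rw [h N, h (F ⊗[R] N), ← Module.FaithfullyFlat.lTensor_exact_iff_exact R F]
  have key {a b : ℕ} (g : (Fin b → R) →ₗ[R] (Fin a → R)) :
      LinearMap.lcomp R (F ⊗[R] N) g ∘ₗ
        (lTensorHomEquivHomLTensor R (Fin a → R) F N).toLinearMap =
      (lTensorHomEquivHomLTensor R (Fin b → R) F N).toLinearMap ∘ₗ
        (LinearMap.lcomp R N g).lTensor F := by
    rw [lTensorHomEquivHomLTensor_toLinearMap, lTensorHomEquivHomLTensor_toLinearMap]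
    ext x φ y
    rfl
  exact (Function.Exact.iff_of_ladder_linearEquiv (key g) (key f)).symm

variable [IsLocalRing R] [IsNoetherianRing R]

instance : IsLocalHom (algebraMap R (AdicCompletion (maximalIdeal R) R)) where
  map_nonunit r hr := by
    by_contra h
    have h1 := hr.map (AdicCompletion.evalₐ (maximalIdeal R) 1)
    rw [AlgHom.commutes] at h1
    have h2 : algebraMap R (R ⧸ maximalIdeal R ^ 1) r = 0 :=
      Ideal.Quotient.eq_zero_iff_mem.2 (by rw [pow_one]; exact h)
    rw [h2, isUnit_zero_iff] at h1
    have : Nontrivial (R ⧸ maximalIdeal R ^ 1) :=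
      Ideal.Quotient.nontrivial_iff.2 (by rw [pow_one]; exact Ideal.IsPrime.ne_top')
    exact zero_ne_one h1

instance : Module.FaithfullyFlat R (AdicCompletion (maximalIdeal R) R) :=
  Module.FaithfullyFlat.of_flat_of_isLocalHom

theorem derivedComplete_adicCompletion_tensor (N : Type u) [AddCommGroup N] [Module R N]
    [Module.Finite R N] {y : R} (hy : y ∈ maximalIdeal R) :
    DerivedComplete y (AdicCompletion (maximalIdeal R) R ⊗[R] N) := by
  have : IsAdicComplete (maximalIdeal R) (AdicCompletion (maximalIdeal R) N) :=
    AdicCompletion.isAdicComplete (IsNoetherian.noetherian _)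
  let e := (AdicCompletion.ofTensorProductEquivOfFiniteNoetherian (maximalIdeal R) N).symm
  refine DerivedComplete.of_addEquiv e.toAddEquiv (fun x => ?_)
    (DerivedComplete.of_isAdicComplete (maximalIdeal R) hy)
  exact (e.restrictScalars R).map_smul y x

/-- For a finite module over a Noetherian local ring, vanishing of a Bass number
strictly after a nonzero one forces all later Bass numbers to vanish. -/
theorem extZero_residue_of_finite {N : Type u} [AddCommGroup N] [Module R N] [Module.Finite R N]
    {a : ℕ} (ha : ¬ ExtZero R (R ⧸ maximalIdeal R) N a)
    (ha' : ExtZero R (R ⧸ maximalIdeal R) N (a + 1)) (t : ℕ) :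
    ExtZero R (R ⧸ maximalIdeal R) N (t + a + 1) := by
  rw [ExtZero.iff_tensor_of_faithfullyFlat _ N (AdicCompletion (maximalIdeal R) R)] at ha ha' ⊢
  exact ModuleCat.extZero_residue_of_derivedComplete
    (Q := ModuleCat.of R (AdicCompletion (maximalIdeal R) R ⊗[R] N))
    (fun y hy => derivedComplete_adicCompletion_tensor N hy) ha ha' t

end Flat

/-! ### From Bass numbers to injective dimension -/

section

variable {R : Type u} [CommRing R]

/-- Baer's criterion after shifting along injective embeddings. -/
theorem hasInjectiveDimensionLT_of_forall_ideal (n : ℕ) (Z : Type u) [AddCommGroup Z] [Module R Z]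
    (h : ∀ J : Ideal R, ExtZero R (R ⧸ J) Z (n + 1)) :
    HasInjectiveDimensionLT (ModuleCat.of R Z) (n + 1) := by
  induction n generalizing Z with
  | zero =>
    have hb : Module.Baer R Z := fun I g => by
      obtain ⟨g', hg'⟩ := ExtZero.exists_extend (f := I.subtype) (g := I.mkQ) Subtype.val_injective
        (LinearMap.exact_subtype_mkQ I) I.mkQ_surjective (h I) g
      exact ⟨g', fun x hx => LinearMap.congr_fun hg' ⟨x, hx⟩⟩
    have : Injective (ModuleCat.of R Z) :=
      (Module.injective_iff_injective_object R Z).1 hb.injective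
    infer_instance
  | succ n ih =>
    obtain ⟨E, ι, hE, hι, -⟩ := ModuleCat.exists_injective_hull (ModuleCat.of R Z)
    have hex : Function.Exact ι (LinearMap.range ι).mkQ := ι.exact_map_mkQ_range
    have hsurj := (LinearMap.range ι).mkQ_surjective
    refine ((ExtZero.shortExact hι hex hsurj).hasInjectiveDimensionLT_X₃_iff n
      ((Module.injective_iff_injective_object R E).1 hE)).1 (ih _ fun J => ?_)
    exact ExtZero.target_third hι hex hsurj (h J) (ExtZero.of_injective n)

variable [IsLocalRing R] [IsNoetherianRing R] {N : Type u} [AddCommGroup N] [Module R N]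
  [Module.Finite R N]

/-- Vanishing of `Ext^(i+1)(C/xC, N)` makes `x` surjective on the finite module `Ext^i(C, N)`;
Nakayama finishes. -/
theorem ExtZero.of_isSMulRegular {C : Type u} [AddCommGroup C] [Module R C] [Module.Finite R C]
    {x : R} (hx : x ∈ maximalIdeal R) {D : Type u} [AddCommGroup D] [Module R D] {g : C →ₗ[R] D}
    (hf : Function.Injective (LinearMap.lsmul R C x))
    (hfg : Function.Exact (LinearMap.lsmul R C x) g) (hg : Function.Surjective g) {i : ℕ}
    (h : ExtZero R D N (i + 1)) : ExtZero R C N i := by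
  let X := ModuleCat.of R C
  let Y := ModuleCat.of R N
  have hle : ∀ e : Ext X Y i, ∃ e' : Ext X Y i, x • e' = e := by
    intro e
    obtain ⟨e', he'⟩ := Ext.contravariant_sequence_exact₁ (ExtZero.shortExact hf hfg hg) Y e
      (add_comm 1 i) (h.elim _ _)
    refine ⟨e', Eq.trans ?_ he'⟩
    have h2 : (Ext.mk₀ (x • 𝟙 X)).comp e' (zero_add i) = x • e' := by
      rw [Ext.mk₀_smul, Ext.smul_comp, Ext.mk₀_id_comp]
    exact h2.symm
  have hfin : Module.Finite R (Ext X Y i) := ModuleCat.finite_ext R X Y i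
  have hbot : (⊤ : Submodule R (Ext X Y i)) = ⊥ :=
    Submodule.eq_bot_of_le_smul_of_le_jacobson_bot (maximalIdeal R) ⊤ (Module.finite_def.1 hfin)
      (fun e _ => by
        obtain ⟨e', rfl⟩ := hle e
        exact Submodule.smul_mem_smul hx trivial) (maximalIdeal_le_jacobson _)
  exact (Submodule.subsingleton_iff R).1 (subsingleton_of_bot_eq_top hbot.symm)

/-- Bass numbers detect the vanishing of `Ext` of all cyclic modules. -/
theorem extZero_quotient_of_residue {a : ℕ}
    (h : ∀ i > a, ExtZero R (R ⧸ maximalIdeal R) N i) (J : Ideal R) :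
    ∀ i > a, ExtZero R (R ⧸ J) N i := by
  induction J using IsNoetherian.induction with
  | hgt J ih =>
  intro i hi
  by_cases hJ : maximalIdeal R ≤ J
  · rcases eq_or_ne J ⊤ with rfl | hne
    · have : Subsingleton (R ⧸ (⊤ : Ideal R)) := Submodule.Quotient.subsingleton_iff.2 rfl
      exact ExtZero.of_subsingleton i
    · rw [((maximalIdeal.isMaximal R).eq_of_le hne hJ).symm]
      exact h i hi
  · have hsup {x : R} (hx : x ∉ J) : ∀ i > a, ExtZero R (R ⧸ (J ⊔ Ideal.span {x})) N i := by
      refine ih _ (lt_of_le_of_ne le_sup_left fun heq => hx ?_)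
      rw [heq]
      exact Ideal.mem_sup_right (Ideal.mem_span_singleton_self x)
    have hle (x : R) : J ≤ J ⊔ Ideal.span {x} := le_sup_left
    have hex (x : R) : Function.Exact (LinearMap.lsmul R (R ⧸ J) x) (Submodule.factor (hle x)) := by
      intro c
      obtain ⟨r, rfl⟩ := Submodule.Quotient.mk_surjective _ c
      constructor
      · intro hr
        have hr' : r ∈ J ⊔ Ideal.span {x} := (Submodule.Quotient.mk_eq_zero _).1 hr
        obtain ⟨j, hj, y, hy, rfl⟩ := Submodule.mem_sup.1 hr'
        obtain ⟨s, rfl⟩ := Ideal.mem_span_singleton'.1 hy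
        refine ⟨Submodule.Quotient.mk s, (Submodule.Quotient.eq _).2 ?_⟩
        change x * s - (j + s * x) ∈ J
        rw [mul_comm, sub_add_cancel_right]
        exact Submodule.neg_mem _ hj
      · rintro ⟨s, hs⟩
        rw [← hs]
        obtain ⟨s, rfl⟩ := Submodule.Quotient.mk_surjective _ s
        refine (Submodule.Quotient.mk_eq_zero _).2 ?_
        change x * s ∈ J ⊔ Ideal.span {x}
        rw [mul_comm]
        exact Ideal.mem_sup_right (Ideal.mul_mem_left _ _ (Ideal.mem_span_singleton_self x))
    -- If `J` is prime, some `x ∈ 𝔪` outside `J` is regular on `R ⧸ J`. Otherwise `0 → R/(J : x) →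
    -- R/J → R/(J + (x)) → 0` has both outer ideals strictly above `J`.
    by_cases hreg : ∀ x ∉ J, ∀ y, x * y ∈ J → y ∈ J
    · obtain ⟨x, hx, hxJ⟩ := Set.not_subset.1 hJ
      refine ExtZero.of_isSMulRegular hx ?_ (hex x) (Submodule.factor_surjective _)
        (hsup hxJ (i + 1) (Nat.lt_succ_of_lt hi))
      rw [injective_iff_map_eq_zero]
      intro c hc
      obtain ⟨r, rfl⟩ := Submodule.Quotient.mk_surjective _ c
      exact (Submodule.Quotient.mk_eq_zero _).2
        (hreg x hxJ r ((Submodule.Quotient.mk_eq_zero _).1 hc))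
    · push Not at hreg
      obtain ⟨x, hx, y, hxy, hy⟩ := hreg
      let m : R →ₗ[R] (R ⧸ J) := J.mkQ ∘ₗ LinearMap.lsmul R R x
      have hlt : J < LinearMap.ker m := by
        refine lt_of_le_of_ne (fun r hr => ?_) fun heq => hy ?_
        · exact (Submodule.Quotient.mk_eq_zero _).2 (Ideal.mul_mem_left J x hr)
        · rw [heq]
          exact (Submodule.Quotient.mk_eq_zero _).2 hxy
      refine ExtZero.middle (f := (LinearMap.ker m).liftQ m le_rfl)
        (LinearMap.ker_eq_bot.1 (Submodule.ker_liftQ_eq_bot' _ _ rfl)) (fun c => ?_)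
        (Submodule.factor_surjective (hle x)) (ih _ hlt i hi) (hsup hx i hi)
      refine (hex x c).trans ⟨?_, ?_⟩
      · rintro ⟨s, rfl⟩
        obtain ⟨s, rfl⟩ := Submodule.Quotient.mk_surjective _ s
        exact ⟨Submodule.Quotient.mk s, rfl⟩
      · rintro ⟨s, rfl⟩
        obtain ⟨s, rfl⟩ := Submodule.Quotient.mk_surjective _ s
        exact ⟨Submodule.Quotient.mk s, rfl⟩

/-- Some Bass number in degree at most the depth is nonzero. -/
theorem exists_not_extZero_residue {n : ℕ} (hn : Module.localDepth R N ≤ (n : ℕ∞)) :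
    ∃ i ≤ n, ¬ ExtZero R (R ⧸ maximalIdeal R) N i := by
  by_contra! h
  obtain ⟨rs, hlen, hmem, hreg⟩ : ∃ rs : List R, rs.length = n + 1 ∧
      (∀ r ∈ rs, r ∈ maximalIdeal R) ∧ RingTheory.Sequence.IsWeaklyRegular N rs := by
    -- For `N = 0` any sequence is weakly regular, so zeros serve.
    rcases subsingleton_or_nontrivial N with hN | hN
    · refine ⟨List.replicate (n + 1) 0, List.length_replicate, fun r hr => ?_,
        (RingTheory.Sequence.isWeaklyRegular_iff N _).2 fun i hi x y _ => ?_⟩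
      · rw [List.eq_of_mem_replicate hr]
        exact Ideal.zero_mem _
      · exact Subsingleton.elim x y
    · have hlt : maximalIdeal R • (⊤ : Submodule R N) < ⊤ := by
        refine lt_top_iff_ne_top.2 fun heq => top_ne_bot (α := Submodule R N) ?_
        exact Submodule.eq_bot_of_le_smul_of_le_jacobson_bot (maximalIdeal R) ⊤
          (Module.finite_def.1 inferInstance) heq.ge (maximalIdeal_le_jacobson _)
      obtain ⟨rs, hlen, hmem, hreg⟩ := ModuleCat.exists_isRegular_of_exists_subsingleton_ext
        (maximalIdeal R) (n + 1) (ModuleCat.of R N) hlt (ModuleCat.of R (R ⧸ maximalIdeal R))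
        (by rw [Module.support_eq_zeroLocus, Ideal.annihilator_quotient])
        fun i hi => h i (Nat.lt_succ_iff.1 hi)
      exact ⟨rs, hlen, hmem, hreg.toIsWeaklyRegular⟩
  have h1 : (rs.length : ℕ∞) ≤ Module.localDepth R N := le_iSup₂_of_le rs ⟨hmem, hreg⟩ le_rfl
  have h2 := h1.trans hn
  rw [hlen, Nat.cast_le] at h2
  omega

/-- If a Bass number of a finite module vanishes in a degree not below the depth, then the injective
dimension is finite. -/
theorem injectiveDimension_lt_top_of_extZero_residue {n : ℕ}
    (hn : Module.localDepth R N ≤ (n : ℕ∞)) (h : ExtZero R (R ⧸ maximalIdeal R) N n) :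
    injectiveDimension (ModuleCat.of R N) < ⊤ := by
  obtain ⟨i, hin, hi⟩ := exists_not_extZero_residue hn
  -- The Bass number is nonzero in degree `i ≤ n` and zero in degree `n`, so it drops to zero
  -- somewhere in between.
  obtain ⟨a, ha, ha'⟩ : ∃ a, ¬ ExtZero R (R ⧸ maximalIdeal R) N a ∧
      ExtZero R (R ⧸ maximalIdeal R) N (a + 1) := by
    by_contra hstep
    rw [not_exists] at hstep
    exact Nat.le_induction (P := fun j _ => ¬ ExtZero R (R ⧸ maximalIdeal R) N j) hi
      (fun j _ hj hj' => hstep j ⟨hj, hj'⟩) n hin h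
  have hall : ∀ j > a, ExtZero R (R ⧸ maximalIdeal R) N j := by
    intro j hj
    obtain ⟨t, rfl⟩ := Nat.exists_eq_add_of_lt hj
    rw [add_comm a t]
    exact extZero_residue_of_finite ha ha' t
  refine lt_top_iff_ne_top.2 ((injectiveDimension_ne_top_iff _).2 ⟨a, ?_⟩)
  exact hasInjectiveDimensionLT_of_forall_ideal a N fun J =>
    extZero_quotient_of_residue hall J (a + 1) (Nat.lt_succ_self a)

end

theorem mainTheorem2 {R : Type u} [CommRing R] [IsLocalRing R] [IsNoetherianRing R]
    {L : Type u} [AddCommGroup L] [Module R L] [Module.Finite R L]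
    {N : Type u} [AddCommGroup N] [Module R N] [Module.Finite R N]
    (M : Submodule R L) (hM : M.IsBurch)
    (n : ℕ) (hn : Module.localDepth R N ≤ (n : ℕ∞))
    (hMN : ∀ i : ℕ, (i : ℤ) = (n : ℤ) - 1 ∨ i = n ∨ i = n + 1 →
      Subsingleton (CategoryTheory.Abelian.Ext (ModuleCat.of R M) (ModuleCat.of R N) i))
    (hLN : ∀ j : ℕ, j = n ∨ j = n + 1 →
      Subsingleton (CategoryTheory.Abelian.Ext (ModuleCat.of R L) (ModuleCat.of R N) j)) :
    CategoryTheory.injectiveDimension (ModuleCat.of R N) < ⊤ :=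
  injectiveDimension_lt_top_of_extZero_residue hn
    (hM.extZero_residue (fun i hi => hMN i (Or.inl (by omega))) (hMN n (Or.inr (Or.inl rfl)))
      (hLN n (Or.inl rfl)))
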